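/- For a set $S$, let $\ell^\infty(S)$ be the space of bounded functions $S\to\mathbb{R}$ with the supremum norm. Maps $X_n$ from probability spaces into a topological space $D$ (not necessarily measurable, each on its own probability space) converge weakly (in the sense of Hoffmann-Jørgensen) to a Borel measurable $D$-valued random element $X$ if $\mathbb{E}^*h(X_n)\to\mathbb{E}h(X)$ for every bounded continuous $h:D\to\mathbb{R}$, where $\mathbb{E}^*$ denotes outer expectation. For $T<\infty$, let $BV_T'$ be the class of right-continuous functions $g:\mathbb{R}\to\mathbb{R}$ with $\|g\|_{TV}\le T$ and $\|g\|_\infty\le T$, where $\|g\|_{TV}$ is the total variation of $g$ over $\mathbb{R}$. **Theorem 1.** For each $n$, let $\{\mathbb{Z}_n(t),\ t\in\mathbb{R}\}$ be a stochastic process whose sample paths are right-continuous, of bounded variation on $\mathbb{R}$, and satisfy $\lim_{|t|\to\infty}\mathbb{Z}_n(t)=0$. Assume that $\mathbb{Z}_n$ converges weakly in $\ell^\infty(\mathbb{R})$, as $n\to\infty$, to a Gaussian process $\{\mathbb{Z}(t),\ t\in\mathbb{R}\}$ whose sample paths are almost surely uniformly continuous with respect to $d(s,t)=|F_0(s)-F_0(t)|$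 for some distribution function $F_0$ on $\mathbb{R}$. For a bounded right-continuous function $g$ of bounded variation, let $\bar{\mathbb{Z}}_n(g)=\int g\,\mathrm{d}\mathbb{Z}_n$ be the (pathwise) Lebesgue–Stieltjes integral. Then, for every $T<\infty$ and every $\mathcal{G}\subseteq BV_T'$, the processes $\{\bar{\mathbb{Z}}_n(g),\ g\in\mathcal{G}\}$ converge weakly in $\ell^\infty(\mathcal{G})$, as $n\to\infty$, to a Gaussian process on $\mathcal{G}$ all of whose sample paths are uniformly continuous with respect to the $L_1(F_0)$ distance $\rho(f,g)=\int|f-g|\,\mathrm{d}F_0$. -/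

import Mathlib

open MeasureTheory ProbabilityTheory Filter Topology
open scoped ENNReal BoundedContinuousFunction

noncomputable section

/-- The outer expectation `E* X`: the infimum of the expectations of the measurable integrable
majorants of `X`. It is only used for bounded `X`, where the set of majorants is nonempty and their
expectations are bounded below (and extended-real-valued majorants give the same infimum). -/
def outerExpectation {Ω : Type*} [MeasurableSpace Ω] (P : Measure Ω) (X : Ω → ℝ) : ℝ :=
  sInf {c : ℝ | ∃ U : Ω → ℝ, Measurable U ∧ Integrable U P ∧ (∀ ω, X ω ≤ U ω) ∧ c = ∫ ω, U ω ∂P}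

/-- Weak convergence in the sense of Hoffmann-Jørgensen of arbitrary (not necessarily measurable)
maps `X n`, each on its own probability space, to a Borel measurable map `Y`. -/
def ConvergesWeaklyHJ {D : Type*} [TopologicalSpace D]
    {Ω : ℕ → Type*} [∀ n, MeasurableSpace (Ω n)] (P : ∀ n, Measure (Ω n)) (X : ∀ n, Ω n → D)
    {Ω' : Type*} [MeasurableSpace Ω'] (P' : Measure Ω') (Y : Ω' → D) : Prop :=
  @Measurable Ω' D _ (borel D) Y ∧
    ∀ h : D →ᵇ ℝ,
      Tendsto (fun n => outerExpectation (P n) (fun ω => h (X n ω))) atTop (𝓝 (∫ ω, h (Y ω) ∂P'))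

/-- The space `ℓ^∞(S)` of bounded real functions on `S`, with the supremum norm. -/
abbrev EllInfty (S : Type*) : Type _ := lp (fun _ : S => ℝ) ∞

/-- The processes `X n` (indexed by `S`) converge weakly in `ℓ^∞(S)` to the process `Y`:
all sample paths are bounded, and the path maps, as maps into `ℓ^∞(S)`, converge weakly. -/
def ProcessConvergesWeakly {S : Type*}
    {Ω : ℕ → Type*} [∀ n, MeasurableSpace (Ω n)] (P : ∀ n, Measure (Ω n)) (X : ∀ n, S → Ω n → ℝ)
    {Ω' : Type*} [MeasurableSpace Ω'] (P' : Measure Ω') (Y : S → Ω' → ℝ) : Prop :=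
  ∃ (hX : ∀ n ω, Memℓp (fun s => X n s ω) ∞) (hY : ∀ ω, Memℓp (fun s => Y s ω) ∞),
    ConvergesWeaklyHJ P (fun n ω => (⟨fun s => X n s ω, hX n ω⟩ : EllInfty S))
      P' (fun ω => (⟨fun s => Y s ω, hY ω⟩ : EllInfty S))

/-- `z` is uniformly continuous with respect to the semi-metric `ρ` on its index set. -/
def UniformlyContinuousFor {S : Type*} (ρ : S → S → ℝ) (z : S → ℝ) : Prop :=
  ∀ ε > 0, ∃ δ > 0, ∀ s t, ρ s t < δ → |z s - z t| < ε

/-- Right-continuity of a function on the real line. -/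
def RightContinuous (f : ℝ → ℝ) : Prop := ∀ x, ContinuousWithinAt f (Set.Ici x) x

/-- The class of right-continuous functions with total variation and supremum norm at most `T`. -/
def rightContBV (T : ℝ) : Set (ℝ → ℝ) :=
  {g | eVariationOn g Set.univ ≤ ENNReal.ofReal T ∧ (∀ x, |g x| ≤ T) ∧ RightContinuous g}

/-- The Lebesgue-Stieltjes integral `∫ g dz` for `z` of bounded variation on the real line: the
integral of `g` against the signed measure associated to `z`. -/
def stieltjesIntegral {z : ℝ → ℝ} (hz : BoundedVariationOn z Set.univ) (g : ℝ → ℝ) : ℝ :=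
  ∫ᵛ x, g x ∂•hz.vectorMeasure

end

/-!
The integral of a right-continuous function `g` of bounded variation makes sense against
integrators `z` that are not of bounded variation, as a Riemann–Stieltjes limit. Summation by parts
bounds the Riemann–Stieltjes sums of `g ∈ rightContBV T` by `3 * T * ‖z‖`, uniformly in the grid
(`abs_riemannSum_le`). Hence the set `stieltjesDomain G` of those `z ∈ ℓ^∞(ℝ)` for which the sums
converge for all `g ∈ G` is closed, and on it the path map `z ↦ (g ↦ ∫ g dz)` into `ℓ^∞(G)` is
Lipschitz. By dominated convergence the domain contains all paths of the `Z n`, and there the limit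
is the Lebesgue–Stieltjes integral (`tendsto_riemannSum_stieltjesIntegral`).

The theorem is then an instance of the continuous mapping theorem. The limit `Z₀` lies in the closed
domain almost surely (`ConvergesWeaklyHJ.ae_mem_of_isClosed`), and a test function composed with the
path map extends to a test function on all of `ℓ^∞(ℝ)` by Tietze's theorem
(`ConvergesWeaklyHJ.comp_of_isClosed`). The limiting process is realized on `ℓ^∞(ℝ)` with the law
of `Z₀`; it is the path map on the set of full measure consisting of the elements of the domain that
are uniformly continuous with respect to `|F₀ s - F₀ t|`, and zero off this set.

* Its finite-dimensional distributions are Gaussian, being almost sure limits of Riemann–Stieltjes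
  sums, which are linear combinations of the values of `Z₀` (`isGaussianProcess_of_tendsto`).
* Its paths are uniformly continuous in `L¹(F₀)`: an integrator `w` that is `L`-Lipschitz with
  respect to `F₀` satisfies `|∫ (f - g) dw| ≤ L * ∫ |f - g| dF₀`, and a bounded uniformly continuous
  integrator is a uniform limit of Lipschitz ones (`exists_lipschitz_approx`).
-/

/-! ### Riemann–Stieltjes sums -/

/-- The `i`-th point of the uniform grid of mesh `1 / (k + 1)` which starts at `-k`. Its points with
index at most `2 * k * (k + 1)` partition `(-k, k]`. -/
noncomputable def gridPoint (k i : ℕ) : ℝ := i / (k + 1) - k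

lemma gridPoint_mono (k : ℕ) : Monotone (gridPoint k) := by
  intro i j hij
  unfold gridPoint
  gcongr

lemma gridPoint_succ (k i : ℕ) : gridPoint k (i + 1) = gridPoint k i + 1 / (k + 1) := by
  unfold gridPoint
  push_cast
  ring

/-- Every point of `(-k, k]` lies in one of the cells of the `k`-th grid. -/
lemma exists_mem_Ioc_gridPoint {k : ℕ} {x : ℝ} (hx : x ∈ Set.Ioc (-k : ℝ) k) :
    ∃ i < 2 * k * (k + 1), x ∈ Set.Ioc (gridPoint k i) (gridPoint k (i + 1)) := by
  obtain ⟨h1, h2⟩ := hx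
  have hk : (0 : ℝ) < k + 1 := by positivity
  have hpos : 0 < ⌈(x + k) * (k + 1)⌉₊ := Nat.ceil_pos.2 (mul_pos (by linarith) hk)
  obtain ⟨i, hi⟩ := Nat.exists_eq_succ_of_ne_zero hpos.ne'
  have h3 := Nat.ceil_lt_add_one (mul_pos (show 0 < x + k by linarith) hk).le
  have h4 := Nat.le_ceil ((x + k) * (k + 1))
  rw [hi] at h3 h4
  push_cast at h3 h4
  refine ⟨i, ?_, ?_, ?_⟩
  · have : ((i : ℕ) : ℝ) < 2 * k * (k + 1) :=
      calc (i : ℝ) < (x + k) * (k + 1) := by linarith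
        _ ≤ 2 * k * (k + 1) := by gcongr; linarith
    exact_mod_cast this
  · have : (i : ℝ) / (k + 1) < x + k := by rw [div_lt_iff₀ hk]; linarith
    unfold gridPoint
    linarith
  · have : x + k ≤ ((i : ℝ) + 1) / (k + 1) := by rw [le_div_iff₀ hk]; linarith
    unfold gridPoint
    push_cast
    linarith

/-- The Riemann–Stieltjes sum of `g` against `z` over the `k`-th grid, where `g` is evaluated at
the right endpoints of the cells. -/
noncomputable def riemannSum (k : ℕ) (g z : ℝ → ℝ) : ℝ :=
  ∑ i ∈ Finset.range (2 * k * (k + 1)),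
    g (gridPoint k (i + 1)) * (z (gridPoint k (i + 1)) - z (gridPoint k i))

/-- The left-continuous step function which equals the value of `g` at the right endpoint on each
cell of the `k`-th grid, and `0` outside `(-k, k]`. -/
noncomputable def stepFun (k : ℕ) (g : ℝ → ℝ) (x : ℝ) : ℝ :=
  ∑ i ∈ Finset.range (2 * k * (k + 1)),
    (Set.Ioc (gridPoint k i) (gridPoint k (i + 1))).indicator (fun _ => g (gridPoint k (i + 1))) x

lemma measurable_stepFun (k : ℕ) (g : ℝ → ℝ) : Measurable (stepFun k g) :=
  Finset.measurable_fun_sum _ fun _ _ => measurable_const.indicator measurableSet_Ioc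

lemma stepFun_eq_of_mem {k i : ℕ} (hi : i < 2 * k * (k + 1)) (g : ℝ → ℝ) {x : ℝ}
    (hx : x ∈ Set.Ioc (gridPoint k i) (gridPoint k (i + 1))) :
    stepFun k g x = g (gridPoint k (i + 1)) := by
  unfold stepFun
  rw [Finset.sum_eq_single i, Set.indicator_of_mem hx]
  · intro j _ hji
    refine Set.indicator_of_notMem (fun hj => ?_) _
    exact Set.disjoint_left.1 ((gridPoint_mono k).pairwise_disjoint_on_Ioc_succ hji) hj hx
  · exact fun h => absurd (Finset.mem_range.2 hi) h

lemma abs_stepFun_le (k : ℕ) {g : ℝ → ℝ} {C : ℝ} (hC : ∀ x, |g x| ≤ C) (x : ℝ) :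
    |stepFun k g x| ≤ C := by
  by_cases h : ∃ i < 2 * k * (k + 1), x ∈ Set.Ioc (gridPoint k i) (gridPoint k (i + 1))
  · obtain ⟨i, hi, hx⟩ := h
    rw [stepFun_eq_of_mem hi g hx]
    exact hC _
  · push Not at h
    unfold stepFun
    rw [Finset.sum_eq_zero fun i hi =>
      Set.indicator_of_notMem (h i (Finset.mem_range.1 hi)) _, abs_zero]
    exact (abs_nonneg _).trans (hC 0)

/-- The step functions of a right-continuous function converge to it pointwise, because the right
endpoint of the cell of `x` approaches `x` from the right. -/
lemma tendsto_stepFun {g : ℝ → ℝ} (hg : RightContinuous g) (x : ℝ) :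
    Tendsto (fun k => stepFun k g x) atTop (𝓝 (g x)) := by
  rw [Metric.tendsto_atTop]
  intro ε hε
  obtain ⟨δ, hδ, h⟩ := Metric.continuousWithinAt_iff.1 (hg x) ε hε
  obtain ⟨n₁, hn₁⟩ := exists_nat_one_div_lt hδ
  obtain ⟨n₂, hn₂⟩ := exists_nat_gt |x|
  refine ⟨max n₁ n₂, fun k hk => ?_⟩
  have hk₂ : |x| < k := hn₂.trans_le (by exact_mod_cast (le_max_right _ _).trans hk)
  have hk₁ : (1 : ℝ) / (k + 1) < δ := by
    refine lt_of_le_of_lt ?_ hn₁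
    have : (n₁ : ℝ) ≤ k := by exact_mod_cast (le_max_left _ _).trans hk
    gcongr
  obtain ⟨i, hi, hx⟩ := exists_mem_Ioc_gridPoint (k := k) (x := x)
    ⟨(abs_lt.1 hk₂).1, (abs_lt.1 hk₂).2.le⟩
  rw [stepFun_eq_of_mem hi g hx]
  refine h (Set.mem_Ici.2 hx.2) ?_
  have h1 := hx.1
  have h2 := hx.2
  rw [gridPoint_succ] at h2 ⊢
  rw [Real.dist_eq, abs_lt]
  constructor <;> linarith

/-- Abel summation. -/
lemma sum_mul_sub_eq (a b : ℕ → ℝ) (N : ℕ) :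
    ∑ i ∈ Finset.range N, a (i + 1) * (b (i + 1) - b i) =
      a N * b N - a 0 * b 0 - ∑ i ∈ Finset.range N, (a (i + 1) - a i) * b i := by
  induction N with
  | zero => simp
  | succ n ih => rw [Finset.sum_range_succ, Finset.sum_range_succ, ih]; ring

lemma riemannSum_sub_right (k : ℕ) (g z w : ℝ → ℝ) :
    riemannSum k g (fun t => z t - w t) = riemannSum k g z - riemannSum k g w := by
  unfold riemannSum
  rw [← Finset.sum_sub_distrib]
  exact Finset.sum_congr rfl fun _ _ => by ring

lemma riemannSum_sub_left (k : ℕ) (f g z : ℝ → ℝ) :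
    riemannSum k (fun t => f t - g t) z = riemannSum k f z - riemannSum k g z := by
  unfold riemannSum
  rw [← Finset.sum_sub_distrib]
  exact Finset.sum_congr rfl fun _ _ => by ring

/-- Riemann–Stieltjes sums are bounded in terms of the supremum norm of the integrator `z`, as
summation by parts moves the variation over to `g`. -/
lemma abs_riemannSum_le (k : ℕ) {T : ℝ} {g : ℝ → ℝ} (hg : g ∈ rightContBV T) {z : ℝ → ℝ} {M : ℝ}
    (hz : ∀ t, |z t| ≤ M) : |riemannSum k g z| ≤ 3 * T * M := by
  obtain ⟨hv, hb, -⟩ := hg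
  have hT : 0 ≤ T := (abs_nonneg _).trans (hb 0)
  have hM : 0 ≤ M := (abs_nonneg _).trans (hz 0)
  set N := 2 * k * (k + 1)
  set a : ℕ → ℝ := fun i => g (gridPoint k i)
  set b : ℕ → ℝ := fun i => z (gridPoint k i)
  have hvar : ∑ i ∈ Finset.range N, |a (i + 1) - a i| ≤ T := by
    have h := (eVariationOn.sum_le (f := g) (s := Set.univ) (n := N) (gridPoint_mono k)
      (fun _ => Set.mem_univ _)).trans hv
    simp_rw [edist_dist, Real.dist_eq] at h
    rw [← ENNReal.ofReal_sum_of_nonneg (fun _ _ => abs_nonneg _)] at h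
    exact (ENNReal.ofReal_le_ofReal_iff hT).1 h
  have hsum : |∑ i ∈ Finset.range N, (a (i + 1) - a i) * b i| ≤ T * M := by
    calc _ ≤ ∑ i ∈ Finset.range N, |(a (i + 1) - a i) * b i| := Finset.abs_sum_le_sum_abs _ _
      _ ≤ ∑ i ∈ Finset.range N, |a (i + 1) - a i| * M := by
          refine Finset.sum_le_sum fun i _ => ?_
          rw [abs_mul]
          gcongr
          exact hz _
      _ ≤ T * M := by rw [← Finset.sum_mul]; gcongr
  have hend : ∀ i, |a i * b i| ≤ T * M := fun i => by
    rw [abs_mul]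
    exact mul_le_mul (hb _) (hz _) (abs_nonneg _) hT
  have hab : riemannSum k g z = _ := sum_mul_sub_eq a b N
  rw [hab]
  have h1 := abs_le.1 (hend N)
  have h2 := abs_le.1 (hend 0)
  have h3 := abs_le.1 hsum
  rw [abs_le]
  constructor <;> linarith [h1.1, h1.2]

lemma isFiniteMeasure_variation_signedMeasure (μ : SignedMeasure ℝ) :
    IsFiniteMeasure μ.variation := by
  rw [← SignedMeasure.totalVariation_eq_variation]
  unfold SignedMeasure.totalVariation
  infer_instance

/-- The Lebesgue–Stieltjes integral is the limit of the Riemann–Stieltjes sums: these are the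
integrals of the step functions, and dominated convergence applies. -/
lemma tendsto_riemannSum_stieltjesIntegral {z : ℝ → ℝ} (hz : BoundedVariationOn z Set.univ)
    (hzr : RightContinuous z) {T : ℝ} {g : ℝ → ℝ} (hg : g ∈ rightContBV T) :
    Tendsto (fun k => riemannSum k g z) atTop (𝓝 (stieltjesIntegral hz g)) := by
  have := isFiniteMeasure_variation_signedMeasure hz.vectorMeasure
  -- `hz.vectorMeasure` is built from right limits
  have hlim : ∀ t, z.rightLim t = z t := fun t =>
    (hzr t).rightLim_eq
  have hsum : ∀ k, ∫ᵛ x, stepFun k g x ∂•hz.vectorMeasure = riemannSum k g z := by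
    intro k
    unfold stepFun riemannSum
    rw [VectorMeasure.integral_finsetSum]
    · refine Finset.sum_congr rfl fun i _ => ?_
      rw [VectorMeasure.integral_indicator measurableSet_Ioc, VectorMeasure.setIntegral_const,
        hz.vectorMeasure_Ioc (gridPoint_mono k (Nat.le_succ i)), hlim, hlim]
      simp
    · intro i _
      exact (integrable_const _).indicator measurableSet_Ioc
  unfold stieltjesIntegral
  simp_rw [← hsum]
  refine VectorMeasure.tendsto_integral_filter_of_norm_le_const
    (.of_forall fun k => (measurable_stepFun k g).aestronglyMeasurable)
    ⟨T, .of_forall fun k => .of_forall fun x => abs_stepFun_le k hg.2.1 x⟩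
    (.of_forall fun x => tendsto_stepFun hg.2.2 x)

lemma integral_stepFun_stieltjesFunction (F : StieltjesFunction ℝ) [IsFiniteMeasure F.measure]
    (k : ℕ) (g : ℝ → ℝ) : ∫ x, stepFun k g x ∂F.measure = riemannSum k g F := by
  unfold stepFun riemannSum
  rw [integral_finsetSum]
  · refine Finset.sum_congr rfl fun i _ => ?_
    rw [integral_indicator_const _ measurableSet_Ioc, measureReal_def, F.measure_Ioc,
      ENNReal.toReal_ofReal (sub_nonneg.2 (F.mono (gridPoint_mono k (Nat.le_succ i)))),
      smul_eq_mul, mul_comm]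
  · intro i _
    exact (integrable_const _).indicator measurableSet_Ioc

/-- The Riemann–Stieltjes sums against a distribution function converge to the integral against
its measure. -/
lemma tendsto_riemannSum_integral (F : StieltjesFunction ℝ) [IsFiniteMeasure F.measure]
    {g : ℝ → ℝ} (hg : RightContinuous g) {C : ℝ} (hC : ∀ x, |g x| ≤ C) :
    Tendsto (fun k => riemannSum k g F) atTop (𝓝 (∫ x, g x ∂F.measure)) := by
  simp_rw [← integral_stepFun_stieltjesFunction]
  exact tendsto_integral_of_dominated_convergence (fun _ => C)
    (fun k => (measurable_stepFun k g).aestronglyMeasurable) (integrable_const _)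
    (fun k => .of_forall fun x => abs_stepFun_le k hC x)
    (.of_forall fun x => tendsto_stepFun hg x)

/-! ### Extending the Stieltjes integral by continuity in the integrator -/

/-- The bounded functions `z` against which every `g ∈ G` has a Riemann–Stieltjes integral, in the
sense that the sums `riemannSum k g z` converge. -/
def stieltjesDomain (G : Set (ℝ → ℝ)) : Set (EllInfty ℝ) :=
  {z | ∀ g ∈ G, ∃ l, Tendsto (fun k => riemannSum k g z) atTop (𝓝 l)}

/-- The limit of the Riemann–Stieltjes sums of `g` against `z`; a junk value unless they
converge. -/
noncomputable def stieltjesLimit (g z : ℝ → ℝ) : ℝ := limUnder atTop fun k => riemannSum k g z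

lemma abs_riemannSum_sub_le (k : ℕ) {T : ℝ} {g : ℝ → ℝ} (hg : g ∈ rightContBV T)
    (z w : EllInfty ℝ) : |riemannSum k g z - riemannSum k g w| ≤ 3 * T * ‖z - w‖ := by
  rw [← riemannSum_sub_right]
  exact abs_riemannSum_le k hg fun t => lp.norm_apply_le_norm ENNReal.top_ne_zero (z - w) t

section
variable {T : ℝ} {G : Set (ℝ → ℝ)}

lemma tendsto_stieltjesLimit {z : EllInfty ℝ} (hz : z ∈ stieltjesDomain G) {g : ℝ → ℝ}
    (hg : g ∈ G) : Tendsto (fun k => riemannSum k g z) atTop (𝓝 (stieltjesLimit g z)) :=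
  tendsto_nhds_limUnder (hz g hg)

/-- The domain is closed, as the Riemann–Stieltjes sums are Lipschitz in the integrator uniformly
in the grid. -/
lemma isClosed_stieltjesDomain (hG : G ⊆ rightContBV T) : IsClosed (stieltjesDomain G) := by
  refine isClosed_of_closure_subset fun z hz g hg => cauchySeq_tendsto_of_complete ?_
  have hT : 0 ≤ T := (abs_nonneg _).trans ((hG hg).2.1 0)
  refine Metric.cauchySeq_iff.2 fun ε hε => ?_
  obtain ⟨w, hw, hzw⟩ := Metric.mem_closure_iff.1 hz (ε / (9 * (T + 1))) (by positivity)
  obtain ⟨N, hN⟩ := Metric.cauchySeq_iff.1 (tendsto_stieltjesLimit hw hg).cauchySeq (ε / 3)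
    (by positivity)
  have hsmall : 3 * T * ‖z - w‖ < ε / 3 := by
    rw [dist_eq_norm, lt_div_iff₀ (by positivity)] at hzw
    nlinarith [norm_nonneg (z - w)]
  refine ⟨N, fun m hm n hn => ?_⟩
  have h1 := abs_le.1 (abs_riemannSum_sub_le m (hG hg) z w)
  have h2 := abs_le.1 (abs_riemannSum_sub_le n (hG hg) z w)
  have h3 := hN m hm n hn
  rw [Real.dist_eq, abs_lt] at h3 ⊢
  constructor <;> linarith [h1.1, h1.2, h2.1, h2.2, h3.1, h3.2]

lemma abs_stieltjesLimit_le (hG : G ⊆ rightContBV T) {z : EllInfty ℝ}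
    (hz : z ∈ stieltjesDomain G) {g : ℝ → ℝ} (hg : g ∈ G) :
    |stieltjesLimit g z| ≤ 3 * T * ‖z‖ :=
  le_of_tendsto' (tendsto_stieltjesLimit hz hg).abs fun k =>
    abs_riemannSum_le k (hG hg) fun t => lp.norm_apply_le_norm ENNReal.top_ne_zero z t

lemma abs_stieltjesLimit_sub_le (hG : G ⊆ rightContBV T) {z w : EllInfty ℝ}
    (hz : z ∈ stieltjesDomain G) (hw : w ∈ stieltjesDomain G) {g : ℝ → ℝ} (hg : g ∈ G) :
    |stieltjesLimit g z - stieltjesLimit g w| ≤ 3 * T * ‖z - w‖ :=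
  le_of_tendsto' ((tendsto_stieltjesLimit hz hg).sub (tendsto_stieltjesLimit hw hg)).abs fun k =>
    abs_riemannSum_sub_le k (hG hg) z w

/-- The path `g ↦ ∫ g dz` in `ℓ^∞(G)` of an integrator `z` in the domain. -/
noncomputable def stieltjesPath (hG : G ⊆ rightContBV T) (z : stieltjesDomain G) : EllInfty G :=
  ⟨fun g => stieltjesLimit g z, memℓp_infty ⟨3 * T * ‖(z : EllInfty ℝ)‖, by
    rintro _ ⟨g, rfl⟩
    exact abs_stieltjesLimit_le hG z.2 g.2⟩⟩

lemma continuous_stieltjesPath (hG : G ⊆ rightContBV T) : Continuous (stieltjesPath hG) := by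
  refine (LipschitzWith.of_dist_le_mul (K := (3 * |T|).toNNReal) fun z w => ?_).continuous
  rw [Real.coe_toNNReal _ (by positivity), dist_eq_norm, Subtype.dist_eq, dist_eq_norm]
  refine lp.norm_le_of_forall_le (by positivity) fun g => ?_
  refine (abs_stieltjesLimit_sub_le hG z.2 w.2 g.2).trans ?_
  gcongr
  exact le_abs_self T

lemma mem_stieltjesDomain_of_boundedVariationOn (hG : G ⊆ rightContBV T) {z : EllInfty ℝ}
    (hz : BoundedVariationOn z Set.univ) (hzr : RightContinuous z) : z ∈ stieltjesDomain G :=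
  fun _ hg => ⟨_, tendsto_riemannSum_stieltjesIntegral hz hzr (hG hg)⟩

/-! ### Uniform continuity of the paths -/

/-- Bounded functions that are uniformly continuous with respect to `|F s - F t|` are uniform limits
of functions that are Lipschitz with respect to it. The approximation is the largest
`L`-Lipschitz minorant, with `L` so large that the points `s` with `δ ≤ |F s - F t|` are
irrelevant for its value at `t`. -/
lemma exists_lipschitz_approx {S : Type*} {F z : S → ℝ} {M : ℝ} (hM : ∀ t, |z t| ≤ M)
    (hz : UniformlyContinuousFor (fun s t => |F s - F t|) z) {ε : ℝ} (hε : 0 < ε) :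
    ∃ L > 0, ∃ w : S → ℝ, (∀ s t, |w s - w t| ≤ L * |F s - F t|) ∧ ∀ t, |z t - w t| ≤ ε := by
  obtain ⟨δ, hδ, h⟩ := hz ε hε
  have hL : 0 < 2 * |M| / δ + 1 := by positivity
  set L := 2 * |M| / δ + 1 with hLdef
  have hLδ : 2 * |M| ≤ L * δ := by
    rw [hLdef, add_mul, div_mul_cancel₀ _ hδ.ne']
    linarith
  have hbdd : ∀ t, BddBelow (Set.range fun s => z s + L * |F s - F t|) := by
    rintro t
    refine ⟨-M, ?_⟩
    rintro _ ⟨s, rfl⟩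
    have := (abs_le.1 (hM s)).1
    have : 0 ≤ L * |F s - F t| := by positivity
    linarith
  have hle : ∀ t u, ⨅ s, (z s + L * |F s - F t|) ≤ z u + L * |F u - F t| := fun t u =>
    ciInf_le (hbdd t) u
  have hlip : ∀ s t, ⨅ u, (z u + L * |F u - F s|) ≤
      (⨅ u, (z u + L * |F u - F t|)) + L * |F s - F t| := by
    intro s t
    have : Nonempty S := ⟨s⟩
    rw [← sub_le_iff_le_add]
    refine le_ciInf fun u => ?_
    have h1 := hle s u
    have h2 : L * |F u - F s| ≤ L * |F u - F t| + L * |F s - F t| := by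
      rw [← mul_add, abs_sub_comm (F s)]
      gcongr
      exact abs_sub_le _ _ _
    linarith
  refine ⟨L, hL, fun t => ⨅ s, (z s + L * |F s - F t|), fun s t => ?_, fun t => ?_⟩
  · have h1 := hlip s t
    have h2 := hlip t s
    rw [abs_sub_comm (F t)] at h2
    rw [abs_le]
    constructor <;> linarith
  · have : Nonempty S := ⟨t⟩
    have h1 := hle t t
    rw [sub_self, abs_zero, mul_zero, add_zero] at h1
    have h2 : z t - ε ≤ ⨅ s, (z s + L * |F s - F t|) := by
      refine le_ciInf fun s => ?_
      rcases lt_or_ge |F s - F t| δ with hs | hs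
      · have h3 := (abs_lt.1 (h s t hs)).1
        have : 0 ≤ L * |F s - F t| := by positivity
        linarith
      · have h3 : L * δ ≤ L * |F s - F t| := by gcongr
        have h4 := (abs_le.1 (hM s)).1
        have h5 := (abs_le.1 (hM t)).2
        linarith [le_abs_self M]
    rw [abs_le]
    constructor <;> linarith

/-- A Riemann–Stieltjes sum against a function that is Lipschitz with respect to `F` is dominated
by the sum of the absolute values against `F`. -/
lemma abs_riemannSum_le_of_lipschitz (k : ℕ) (g : ℝ → ℝ) {F w : ℝ → ℝ} (hF : Monotone F) {L : ℝ}
    (hw : ∀ s t, |w s - w t| ≤ L * |F s - F t|) :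
    |riemannSum k g w| ≤ L * riemannSum k (fun t => |g t|) F := by
  unfold riemannSum
  rw [Finset.mul_sum]
  refine (Finset.abs_sum_le_sum_abs _ _).trans (Finset.sum_le_sum fun i _ => ?_)
  have h := hw (gridPoint k (i + 1)) (gridPoint k i)
  rw [abs_of_nonneg (sub_nonneg.2 (hF (gridPoint_mono k (Nat.le_succ i))))] at h
  rw [abs_mul, mul_left_comm]
  gcongr

/-- The paths `g ↦ ∫ g dz` are uniformly continuous in `L¹(F)` when `z` is uniformly continuous
with respect to `F`: this is clear when `z` is Lipschitz with respect to `F`, and the general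
case follows by uniform approximation of `z`. -/
lemma uniformlyContinuousFor_stieltjesLimit (hG : G ⊆ rightContBV T) (F : StieltjesFunction ℝ)
    [IsFiniteMeasure F.measure] {z : EllInfty ℝ} (hz : z ∈ stieltjesDomain G)
    (hzF : UniformlyContinuousFor (fun s t => |F s - F t|) z) :
    UniformlyContinuousFor
      (fun f g : G => ∫ x, |(f : ℝ → ℝ) x - (g : ℝ → ℝ) x| ∂F.measure)
      (fun g : G => stieltjesLimit g z) := by
  intro ε hε
  have hη : 0 < ε / (12 * (|T| + 1)) := by positivity
  obtain ⟨L, hL, w, hwL, hzw⟩ := exists_lipschitz_approx (F := F)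
    (fun t => lp.norm_apply_le_norm ENNReal.top_ne_zero z t) hzF hη
  set η := ε / (12 * (|T| + 1)) with hηdef
  refine ⟨ε / (2 * L), by positivity, fun f g hfg => ?_⟩
  have hf := hG f.2
  have hg := hG g.2
  have hT : 0 ≤ T := (abs_nonneg _).trans (hf.2.1 0)
  have hkey : ∀ k, |riemannSum k f z - riemannSum k g z| ≤
      6 * T * η + L * riemannSum k (fun t => |(f : ℝ → ℝ) t - (g : ℝ → ℝ) t|) F := by
    intro k
    have h1 := abs_le.1 (abs_riemannSum_le k hf hzw)
    have h2 := abs_le.1 (abs_riemannSum_le k hg hzw)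
    have h3 := abs_le.1 (abs_riemannSum_le_of_lipschitz k
      (fun t => (f : ℝ → ℝ) t - (g : ℝ → ℝ) t) F.mono hwL)
    rw [riemannSum_sub_right] at h1 h2
    rw [riemannSum_sub_left] at h3
    rw [abs_le]
    constructor <;> linarith [h1.1, h1.2, h2.1, h2.2, h3.1, h3.2]
  have hlim := tendsto_riemannSum_integral F (g := fun t => |(f : ℝ → ℝ) t - (g : ℝ → ℝ) t|)
    (fun x => ((hf.2.2 x).sub (hg.2.2 x)).abs) (C := 2 * T) fun x => by
      rw [abs_abs]
      have h1 := abs_le.1 (hf.2.1 x)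
      have h2 := abs_le.1 (hg.2.1 x)
      rw [abs_le]
      constructor <;> linarith [h1.1, h1.2, h2.1, h2.2]
  have hle := le_of_tendsto_of_tendsto'
    ((tendsto_stieltjesLimit hz f.2).sub (tendsto_stieltjesLimit hz g.2)).abs
    ((hlim.const_mul L).const_add (6 * T * η)) hkey
  refine hle.trans_lt ?_
  have h4 : 6 * T * η ≤ ε / 2 := by
    rw [hηdef, abs_of_nonneg hT, mul_div_assoc', div_le_div_iff₀ (by positivity) (by norm_num)]
    nlinarith
  have h5 : L * ∫ x, |(f : ℝ → ℝ) x - (g : ℝ → ℝ) x| ∂F.measure < ε / 2 := by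
    rw [lt_div_iff₀ (by positivity)] at hfg
    linarith
  linarith

lemma isClosed_uniformlyContinuousFor {S : Type*} (ρ : S → S → ℝ) :
    IsClosed {z : EllInfty S | UniformlyContinuousFor ρ z} := by
  refine isClosed_of_closure_subset fun z hz ε hε => ?_
  obtain ⟨w, hw, hzw⟩ := Metric.mem_closure_iff.1 hz (ε / 3) (by positivity)
  obtain ⟨δ, hδ, h⟩ := hw (ε / 3) (by positivity)
  refine ⟨δ, hδ, fun s t hst => ?_⟩
  have hb : ∀ s, |z s - w s| < ε / 3 := fun s =>
    (lp.norm_apply_le_norm ENNReal.top_ne_zero (z - w) s).trans_lt (by rwa [← dist_eq_norm])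
  have h1 := abs_lt.1 (hb s)
  have h2 := abs_lt.1 (hb t)
  have h3 := abs_lt.1 (h s t hst)
  rw [abs_lt]
  constructor <;> linarith [h1.1, h1.2, h2.1, h2.2, h3.1, h3.2]

end

/-! ### Almost sure limits of Gaussian processes -/

/-- An almost surely convergent sequence of real random variables is bounded by a constant on an event
of probability more than `1 / 2`. -/
lemma exists_bound_measure_gt {Ω : Type*} [MeasurableSpace Ω] {P : Measure Ω}
    [IsProbabilityMeasure P] {X : ℕ → Ω → ℝ} {Y : Ω → ℝ}
    (h : ∀ᵐ ω ∂P, Tendsto (fun k => X k ω) atTop (𝓝 (Y ω))) :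
    ∃ M : ℕ, 1 / 2 < P {ω | ∀ k, |X k ω| ≤ M} := by
  have hmono : Monotone fun M : ℕ => {ω | ∀ k, |X k ω| ≤ M} := fun a b hab ω hω k =>
    (hω k).trans (by exact_mod_cast hab)
  have hlim := tendsto_measure_iUnion_atTop (μ := P) hmono
  have hone : P (⋃ M : ℕ, {ω | ∀ k, |X k ω| ≤ M}) = 1 := by
    rw [← measure_univ (μ := P)]
    refine measure_congr (eventuallyEq_univ.2 ?_)
    filter_upwards [h] with ω hω
    obtain ⟨C, hC⟩ := (Metric.isBounded_range_of_tendsto _ hω).exists_norm_le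
    obtain ⟨M, hM⟩ := exists_nat_ge C
    exact Set.mem_iUnion.2 ⟨M, fun k => (hC _ ⟨k, rfl⟩).trans hM⟩
  rw [hone] at hlim
  exact (hlim.eventually_const_lt (by norm_num : (1 / 2 : ℝ≥0∞) < 1)).exists

/-- An almost sure limit of real Gaussian random variables is Gaussian. The moduli of the
characteristic functions force the variances to converge; by Chebyshev's inequality the means are
then bounded, hence converge along a subsequence. -/
lemma exists_map_eq_gaussianReal_of_tendsto {Ω : Type*} [MeasurableSpace Ω] {P : Measure Ω}
    [IsProbabilityMeasure P] {X : ℕ → Ω → ℝ} {Y : Ω → ℝ} (hX : ∀ k, HasGaussianLaw (X k) P)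
    (h : ∀ᵐ ω ∂P, Tendsto (fun k => X k ω) atTop (𝓝 (Y ω))) :
    ∃ m v, P.map Y = gaussianReal m v := by
  have hXm : ∀ k, AEMeasurable (X k) P := fun k => (hX k).aemeasurable
  have hYm : AEMeasurable Y P := aemeasurable_of_tendsto_metrizable_ae atTop hXm h
  set m : ℕ → ℝ := fun k => P[X k]
  set v : ℕ → ℝ := fun k => Var[X k; P]
  have hv0 : ∀ k, 0 ≤ v k := fun k => variance_nonneg _ _
  have := P.isProbabilityMeasure_map hYm
  have hchar : ∀ t : ℝ, Tendsto
      (fun k => Complex.exp (t * m k * Complex.I - v k * t ^ 2 / 2)) atTop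
      (𝓝 (charFun (P.map Y) t)) := by
    intro t
    have hk : ∀ k, Complex.exp (t * m k * Complex.I - v k * t ^ 2 / 2)
        = ∫ ω, Complex.exp (t * X k ω * Complex.I) ∂P := by
      intro k
      have h1 := charFun_gaussianReal (μ := m k) (v := (v k).toNNReal) t
      rw [← (hX k).map_eq_gaussianReal, charFun_apply_real,
        integral_map (hXm k) (by fun_prop)] at h1
      rw [h1, Real.coe_toNNReal _ (hv0 k)]
    simp_rw [hk]
    rw [charFun_apply_real, integral_map hYm (by fun_prop)]
    refine tendsto_integral_of_dominated_convergence (fun _ => 1) (fun k => ?_)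
      (integrable_const _) (fun k => .of_forall fun ω => ?_) ?_
    · have := hXm k
      exact (by fun_prop : AEMeasurable _ P).aestronglyMeasurable
    · rw [← Complex.ofReal_mul, Complex.norm_exp_ofReal_mul_I]
    · filter_upwards [h] with ω hω
      exact ((by fun_prop : Continuous fun x : ℝ =>
        Complex.exp (t * x * Complex.I)).tendsto _).comp hω
  -- a point away from the origin at which the limiting characteristic function does not vanish
  obtain ⟨s, hs, hs0⟩ : ∃ s : ℝ, charFun (P.map Y) s ≠ 0 ∧ s ≠ 0 := by
    have hc : ContinuousAt (charFun (P.map Y)) 0 := continuous_charFun.continuousAt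
    have h1 : ∀ᶠ s in 𝓝[≠] (0 : ℝ), charFun (P.map Y) s ≠ 0 :=
      (hc.eventually_ne (by simp)).filter_mono nhdsWithin_le_nhds
    exact (h1.and self_mem_nhdsWithin).exists
  obtain ⟨V, hV⟩ : ∃ V, Tendsto v atTop (𝓝 V) := by
    have h1 := (hchar s).norm
    simp_rw [Complex.norm_exp] at h1
    have h2 := (h1.log (norm_ne_zero_iff.2 hs)).const_mul (-2 / s ^ 2)
    refine ⟨_, h2.congr fun k => ?_⟩
    rw [Real.log_exp]
    have : (s * m k * Complex.I - v k * s ^ 2 / 2 : ℂ).re = - v k * s ^ 2 / 2 := by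
      have : (s * m k * Complex.I - v k * s ^ 2 / 2 : ℂ) =
          ((-v k * s ^ 2 / 2 : ℝ) : ℂ) + ((s * m k : ℝ) : ℂ) * Complex.I := by
        push_cast; ring
      rw [this, Complex.add_re, Complex.ofReal_re, Complex.re_ofReal_mul, Complex.I_re]
      ring
    rw [this]
    field_simp
  have hV0 : 0 ≤ V := ge_of_tendsto' hV hv0
  obtain ⟨R, hR⟩ := (Metric.isBounded_range_of_tendsto _ hV).exists_norm_le
  obtain ⟨M, hM⟩ := exists_bound_measure_gt h
  have hR0 : 0 ≤ R := (norm_nonneg _).trans (hR _ ⟨0, rfl⟩)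
  have hm : ∀ k, m k ∈ Metric.closedBall (0 : ℝ) (M + (2 * R + 2)) := by
    intro k
    -- the variances are at most `R`, and `R / (2 * R + 2) ^ 2 ≤ 1 / 2`, so that some point of the
    -- event from `exists_bound_measure_gt` is within `2 * R + 2` of the mean
    have hc : (0 : ℝ) < 2 * R + 2 := by linarith
    have hcheb := meas_ge_le_variance_div_sq (hX k).memLp_two hc
    have hlt : P {ω | 2 * R + 2 ≤ |X k ω - P[X k]|} < P {ω | ∀ k, |X k ω| ≤ M} := by
      refine (hcheb.trans ?_).trans_lt hM
      rw [show (1 / 2 : ℝ≥0∞) = ENNReal.ofReal (1 / 2) by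
        rw [ENNReal.ofReal_div_of_pos (by norm_num)]; simp]
      refine ENNReal.ofReal_le_ofReal ?_
      have hvk : v k ≤ R := (le_abs_self _).trans (hR _ ⟨k, rfl⟩)
      rw [div_le_div_iff₀ (by positivity) (by norm_num)]
      change v k * 2 ≤ _
      nlinarith
    obtain ⟨ω, hω, hω'⟩ := Set.not_subset.1 fun hsub => (measure_mono hsub).not_gt hlt
    simp only [Set.mem_ofPred_eq, not_le] at hω hω'
    rw [mem_closedBall_zero_iff, Real.norm_eq_abs]
    calc |m k| = |X k ω - (X k ω - m k)| := by congr 1; ring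
      _ ≤ |X k ω| + |X k ω - m k| := abs_sub _ _
      _ ≤ _ := add_le_add (hω k) hω'.le
  obtain ⟨μ, -, φ, hφ, hμ⟩ := tendsto_subseq_of_bounded Metric.isBounded_closedBall hm
  refine ⟨μ, V.toNNReal, Measure.ext_of_charFun ?_⟩
  ext t
  rw [charFun_gaussianReal, Real.coe_toNNReal _ hV0]
  refine tendsto_nhds_unique ((hchar t).comp hφ.tendsto_atTop) ?_
  have hcont : Continuous fun p : ℝ × ℝ =>
      Complex.exp (t * p.1 * Complex.I - p.2 * t ^ 2 / 2) := by fun_prop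
  have hpair := hμ.prodMk_nhds (hV.comp hφ.tendsto_atTop)
  simpa only [Function.comp_def] using (hcont.tendsto (μ, V)).comp hpair

/-- An almost sure pointwise limit of Gaussian processes is a Gaussian process. -/
lemma isGaussianProcess_of_tendsto {Ω S : Type*} [MeasurableSpace Ω] {P : Measure Ω}
    [IsProbabilityMeasure P] {X : ℕ → S → Ω → ℝ} {Y : S → Ω → ℝ}
    (hX : ∀ k, IsGaussianProcess (X k) P)
    (h : ∀ s, ∀ᵐ ω ∂P, Tendsto (fun k => X k s ω) atTop (𝓝 (Y s ω))) :
    IsGaussianProcess Y P where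
  hasGaussianLaw I := by
    constructor
    have hYm : ∀ s, AEMeasurable (Y s) P := fun s =>
      aemeasurable_of_tendsto_metrizable_ae atTop (fun k => (hX k).aemeasurable s) (h s)
    have hIm : AEMeasurable (fun ω => I.restrict (Y · ω)) P :=
      aemeasurable_pi_lambda _ fun s => hYm s
    refine isGaussian_of_map_eq_gaussianReal fun L => ?_
    rw [AEMeasurable.map_map_of_aemeasurable (by fun_prop) hIm]
    refine exists_map_eq_gaussianReal_of_tendsto
      (fun k => ((hX k).hasGaussianLaw I).map L) ?_
    have hall : ∀ᵐ ω ∂P, ∀ s : I, Tendsto (fun k => X k s ω) atTop (𝓝 (Y s ω)) :=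
      ae_all_iff.2 fun s => h s
    filter_upwards [hall] with ω hω
    exact (L.continuous.tendsto _).comp (tendsto_pi_nhds.2 hω)

/-! ### Weak convergence in the sense of Hoffmann-Jørgensen -/

lemma outerExpectation_zero {Ω : Type*} [MeasurableSpace Ω] (P : Measure Ω) :
    outerExpectation P (fun _ => 0) = 0 := by
  refine IsLeast.csInf_eq ⟨⟨fun _ => 0, measurable_const, integrable_zero _ _ _, fun _ => le_rfl,
    by simp⟩, ?_⟩
  rintro _ ⟨U, -, -, hU, rfl⟩
  exact integral_nonneg hU

section
variable {Ω : ℕ → Type*} [∀ n, MeasurableSpace (Ω n)] {P : ∀ n, Measure (Ω n)}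
  {Ω' : Type*} [MeasurableSpace Ω'] {P' : Measure Ω'}

/-- A closed set that contains all values of the converging maps contains almost all values of the
limit: test the convergence on the truncated distance to the set. -/
lemma ConvergesWeaklyHJ.ae_mem_of_isClosed {D : Type*} [PseudoMetricSpace D]
    {X : ∀ n, Ω n → D} [IsFiniteMeasure P'] {Y : Ω' → D} (h : ConvergesWeaklyHJ P X P' Y)
    {A : Set D} (hA : IsClosed A) (hne : A.Nonempty) (hX : ∀ n ω, X n ω ∈ A) :
    ∀ᵐ ω ∂P', Y ω ∈ A := by
  borelize D
  obtain ⟨hY, hlim⟩ := h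
  let φ : D →ᵇ ℝ := BoundedContinuousFunction.ofNormedAddCommGroup
    (fun x => min 1 (Metric.infDist x A))
    (continuous_const.min (Metric.continuous_infDist_pt A)) 1 fun x => by
      rw [Real.norm_of_nonneg (le_min zero_le_one Metric.infDist_nonneg)]
      exact min_le_left _ _
  have hφ0 : ∀ x, 0 ≤ φ x := fun x => le_min zero_le_one Metric.infDist_nonneg
  have hφX : ∀ n ω, φ (X n ω) = 0 := fun n ω => by
    change min 1 (Metric.infDist (X n ω) A) = 0
    rw [Metric.infDist_zero_of_mem (hX n ω)]
    simp
  have hint : ∫ ω, φ (Y ω) ∂P' = 0 := by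
    refine tendsto_nhds_unique (hlim φ) ?_
    simp_rw [hφX, outerExpectation_zero]
    exact tendsto_const_nhds
  have hmeas : Measurable fun ω => φ (Y ω) := φ.continuous.measurable.comp hY
  have hi : Integrable (fun ω => φ (Y ω)) P' :=
    .of_bound hmeas.aestronglyMeasurable ‖φ‖ (.of_forall fun ω => φ.norm_coe_le_norm _)
  filter_upwards [(integral_eq_zero_iff_of_nonneg (fun ω => hφ0 (Y ω)) hi).1 hint] with ω hω
  have hω' : min 1 (Metric.infDist (Y ω) A) = 0 := hω
  refine (hA.mem_iff_infDist_zero hne).2 ?_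
  rcases min_choice 1 (Metric.infDist (Y ω) A) with h1 | h1 <;> linarith

/-- Weak convergence only depends on the law of the limit. -/
lemma ConvergesWeaklyHJ.id_map {D : Type*} [TopologicalSpace D] [MeasurableSpace D] [BorelSpace D]
    {X : ∀ n, Ω n → D} {Y : Ω' → D} (h : ConvergesWeaklyHJ P X P' Y) :
    ConvergesWeaklyHJ P X (P'.map Y) id := by
  have hY : Measurable Y := h.1.mono le_rfl BorelSpace.measurable_eq.le
  refine ⟨measurable_id.mono le_rfl BorelSpace.measurable_eq.ge, fun φ => ?_⟩
  simp_rw [id]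
  rw [integral_map hY.aemeasurable φ.continuous.measurable.aestronglyMeasurable]
  exact h.2 φ

/-- Continuous mapping theorem for a map defined on a closed set which contains all values of the
converging maps. By Tietze's theorem, the composition of the map with a test function extends to a
test function on the whole space. -/
lemma ConvergesWeaklyHJ.comp_of_isClosed {D E : Type*} [TopologicalSpace D] [NormalSpace D]
    [TopologicalSpace E] {X : ∀ n, Ω n → D} {Y : Ω' → D} (h : ConvergesWeaklyHJ P X P' Y)
    {A : Set D} (hA : IsClosed A) (hX : ∀ n ω, X n ω ∈ A) {H : A → E} (hH : Continuous H)
    {Y' : Ω' → E} (hY' : @Measurable Ω' E _ (borel E) Y')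
    (hYY' : ∀ᵐ ω ∂P', ∃ hω : Y ω ∈ A, Y' ω = H ⟨Y ω, hω⟩) :
    ConvergesWeaklyHJ P (fun n ω => H ⟨X n ω, hX n ω⟩) P' Y' := by
  refine ⟨hY', fun φ => ?_⟩
  obtain ⟨ψ, -, hψ⟩ := BoundedContinuousFunction.exists_norm_eq_domRestrict_eq_of_closed
    (φ.compContinuous ⟨H, hH⟩) hA
  have hψH : ∀ x : A, φ (H x) = ψ x := fun x => (DFunLike.congr_fun hψ x).symm
  simp_rw [hψH]
  have hint : ∫ ω, φ (Y' ω) ∂P' = ∫ ω, ψ (Y ω) ∂P' := by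
    refine integral_congr_ae ?_
    filter_upwards [hYY'] with ω ⟨hω, hω'⟩
    rw [hω', hψH]
  rw [hint]
  exact h.2 ψ

end

/-! ### The Gaussian limit -/

/-- Riemann–Stieltjes sums against a Gaussian process form a Gaussian process, being finite linear
combinations of its values. -/
lemma isGaussianProcess_riemannSum {Ω : Type*} [MeasurableSpace Ω] {P : Measure Ω}
    {Z : ℝ → Ω → ℝ} (hZ : IsGaussianProcess Z P) (G : Set (ℝ → ℝ)) (k : ℕ) :
    IsGaussianProcess (fun (g : G) ω => riemannSum k g (Z · ω)) P := by
  classical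
  refine hZ.of_isGaussianProcess fun g =>
    ⟨(Finset.range (2 * k * (k + 1) + 1)).image (gridPoint k), LinearMap.toContinuousLinearMap
      { toFun := fun x => riemannSum k g (Function.extend Subtype.val x 0)
        map_add' := fun x y => ?_
        map_smul' := fun c x => ?_ }, fun ω => ?_⟩
  · have : Function.extend Subtype.val (x + y) (0 : ℝ → ℝ) =
        Function.extend Subtype.val x 0 + Function.extend Subtype.val y 0 := by
      rw [← Function.extend_add, add_zero]
    rw [this]
    unfold riemannSum
    rw [← Finset.sum_add_distrib]
    exact Finset.sum_congr rfl fun _ _ => by simp only [Pi.add_apply]; ring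
  · have : Function.extend Subtype.val (c • x) (0 : ℝ → ℝ) =
        c • Function.extend Subtype.val x 0 := by
      rw [← Function.extend_smul, smul_zero]
    rw [this]
    unfold riemannSum
    rw [RingHom.id_apply, smul_eq_mul, Finset.mul_sum]
    exact Finset.sum_congr rfl fun _ _ => by simp only [Pi.smul_apply, smul_eq_mul]; ring
  · have hval : ∀ i < 2 * k * (k + 1) + 1, Function.extend Subtype.val
        (((Finset.range (2 * k * (k + 1) + 1)).image (gridPoint k)).restrict (Z · ω)) 0
          (gridPoint k i) = Z (gridPoint k i) ω := fun i hi =>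
      Subtype.val_injective.extend_apply _ _
        (⟨gridPoint k i, Finset.mem_image_of_mem _ (Finset.mem_range.2 hi)⟩ : Finset.image _ _)
    change riemannSum k g _ = riemannSum k g _
    unfold riemannSum
    refine Finset.sum_congr rfl fun i hi => ?_
    rw [Finset.mem_range] at hi
    rw [hval i (by omega), hval (i + 1) (by omega)]

/-- The coordinates on `ℓ^∞(S)` form a Gaussian process under the law of a Gaussian process. -/
lemma isGaussianProcess_eval_map {S Ω : Type*} [MeasurableSpace Ω] {P : Measure Ω}
    [MeasurableSpace (EllInfty S)] [BorelSpace (EllInfty S)] {Z : Ω → EllInfty S}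
    (hZ : IsGaussianProcess (fun s ω => Z ω s) P) (hm : Measurable Z) :
    IsGaussianProcess (fun s (z : EllInfty S) => z s) (P.map Z) where
  hasGaussianLaw I := by
    constructor
    have hcoord : ∀ s : S, Measurable fun z : EllInfty S => z s := fun s =>
      (LipschitzWith.of_dist_le_mul (K := 1) fun z w => by
        rw [NNReal.coe_one, one_mul, dist_eq_norm z w]
        exact lp.norm_apply_le_norm ENNReal.top_ne_zero (z - w) s).continuous.measurable
    have hmap := Measure.map_map (μ := P) (g := fun (z : EllInfty S) (s : I) => z s)
      (measurable_pi_lambda _ fun s => hcoord s) hm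
    have hgauss : IsGaussian (P.map ((fun (z : EllInfty S) (s : I) => z s) ∘ Z)) :=
      (hZ.hasGaussianLaw I).isGaussian_map
    rw [← hmap] at hgauss
    exact hgauss

theorem theorem1
    {Ω : ℕ → Type*} [∀ n, MeasurableSpace (Ω n)]
    (P : ∀ n, Measure (Ω n)) [∀ n, IsProbabilityMeasure (P n)]
    (Z : ∀ n, ℝ → Ω n → ℝ)
    (hZ_bot : ∀ n ω, Tendsto (fun t => Z n t ω) atBot (𝓝 0))
    (hZ_top : ∀ n ω, Tendsto (fun t => Z n t ω) atTop (𝓝 0))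
    (hZ_rc : ∀ n ω, RightContinuous (fun t => Z n t ω))
    (hZ_bv : ∀ n ω, BoundedVariationOn (fun t => Z n t ω) Set.univ)
    (F₀ : StieltjesFunction ℝ)
    (hF₀_bot : Tendsto F₀ atBot (𝓝 0)) (hF₀_top : Tendsto F₀ atTop (𝓝 1))
    {Ω₀ : Type*} [MeasurableSpace Ω₀] (P₀ : Measure Ω₀) [IsProbabilityMeasure P₀]
    (Z₀ : ℝ → Ω₀ → ℝ)
    (hZ₀_gauss : IsGaussianProcess Z₀ P₀)
    (hZ₀_cont : ∀ᵐ ω ∂P₀,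
      UniformlyContinuousFor (fun s t => |F₀ s - F₀ t|) (fun t => Z₀ t ω))
    (h_conv : ProcessConvergesWeakly P Z P₀ Z₀)
    (T : ℝ) (G : Set (ℝ → ℝ)) (hG : G ⊆ rightContBV T) :
    ∃ (Ω₁ : Type) (_ : MeasurableSpace Ω₁) (P₁ : Measure Ω₁) (_ : IsProbabilityMeasure P₁)
      (Y : G → Ω₁ → ℝ),
      IsGaussianProcess Y P₁ ∧
      (∀ ω, UniformlyContinuousFor
        (fun f g : G => ∫ x, |(f : ℝ → ℝ) x - (g : ℝ → ℝ) x| ∂F₀.measure) (fun g => Y g ω)) ∧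
      ProcessConvergesWeakly P
        (fun n (g : G) ω => stieltjesIntegral (hZ_bv n ω) (g : ℝ → ℝ)) P₁ Y := by
  classical
  have := F₀.isProbabilityMeasure hF₀_bot hF₀_top
  obtain ⟨hX, hY, hw⟩ := h_conv
  set X' : ∀ n, Ω n → EllInfty ℝ := fun n ω => ⟨fun s => Z n s ω, hX n ω⟩
  set Z' : Ω₀ → EllInfty ℝ := fun ω => ⟨fun s => Z₀ s ω, hY ω⟩
  borelize (EllInfty ℝ) (EllInfty G)
  have hZ'm : Measurable Z' := hw.1
  have hdom := isClosed_stieltjesDomain hG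
  have hXdom : ∀ n ω, X' n ω ∈ stieltjesDomain G := fun n ω =>
    mem_stieltjesDomain_of_boundedVariationOn hG (hZ_bv n ω) (hZ_rc n ω)
  set U : Set (EllInfty ℝ) := {z | UniformlyContinuousFor (fun s t => |F₀ s - F₀ t|) z}
  have hU : IsClosed U := isClosed_uniformlyContinuousFor _
  have hP₁ : IsProbabilityMeasure (P₀.map Z') := P₀.isProbabilityMeasure_map hZ'm.aemeasurable
  have hae : ∀ᵐ z ∂P₀.map Z', z ∈ stieltjesDomain G ∩ U := by
    refine (ae_map_iff hZ'm.aemeasurable (hdom.inter hU).measurableSet).2 ?_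
    have hne : (stieltjesDomain G).Nonempty := ⟨0, fun g _ => ⟨0, by simp [riemannSum]⟩⟩
    filter_upwards [hw.ae_mem_of_isClosed hdom hne hXdom, hZ₀_cont] with ω h1 h2
    exact ⟨h1, h2⟩
  let path : EllInfty ℝ → EllInfty G := fun z =>
    if h : z ∈ stieltjesDomain G ∩ U then stieltjesPath hG ⟨z, h.1⟩ else 0
  have hpath : ∀ z (h : z ∈ stieltjesDomain G ∩ U), path z = stieltjesPath hG ⟨z, h.1⟩ :=
    fun z h => dif_pos h
  have hpath_meas : Measurable path :=
    Measurable.dite (s := stieltjesDomain G ∩ U)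
      (f := fun z => stieltjesPath hG ⟨z, z.2.1⟩) (g := fun _ => 0)
      ((continuous_stieltjesPath hG).comp (by fun_prop)).measurable measurable_const
      (hdom.inter hU).measurableSet
  refine ⟨EllInfty ℝ, inferInstance, P₀.map Z', hP₁, fun g z => path z g, ?_, fun z => ?_, ?_⟩
  · refine isGaussianProcess_of_tendsto (fun k => isGaussianProcess_riemannSum
      (isGaussianProcess_eval_map (Z := Z') hZ₀_gauss hZ'm) G k) fun g => ?_
    filter_upwards [hae] with z hz
    rw [hpath z hz]
    exact tendsto_stieltjesLimit hz.1 g.2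
  · change UniformlyContinuousFor _ (path z)
    by_cases hz : z ∈ stieltjesDomain G ∩ U
    · rw [hpath z hz]
      exact uniformlyContinuousFor_stieltjesLimit hG F₀ hz.1 hz.2
    · have h0 : path z = 0 := dif_neg hz
      rw [h0]
      exact fun ε hε => ⟨1, one_pos, fun _ _ _ => by simpa using hε⟩
  · have hint : ∀ n ω (g : G), stieltjesIntegral (hZ_bv n ω) (g : ℝ → ℝ) =
        stieltjesPath hG ⟨X' n ω, hXdom n ω⟩ g := fun n ω g =>
      tendsto_nhds_unique
        (tendsto_riemannSum_stieltjesIntegral (hZ_bv n ω) (hZ_rc n ω) (hG g.2))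
        (tendsto_stieltjesLimit (hXdom n ω) g.2)
    simp_rw [hint]
    refine ⟨fun n ω => lp.memℓp _, fun z => lp.memℓp _, ?_⟩
    exact hw.id_map.comp_of_isClosed hdom hXdom (continuous_stieltjesPath hG) hpath_meas
      (hae.mono fun z hz => ⟨hz.1, hpath z hz⟩)
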